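/- Let $A$ be a real $n\times n$ matrix, $n\ge 2$. Its second compound matrix $A^{(2)}$ is the matrix, indexed by the pairs $(i,j)$ with $1\le i<j\le n$, whose entry in row $(i,j)$ and column $(k,l)$ is the minor $a_{ik}a_{jl}-a_{il}a_{jk}$. A matrix is reducible if a simultaneous permutation of its rows and columns brings it to the form $\begin{pmatrix}A_1&0\\B&A_2\end{pmatrix}$ with square blocks $A_1,A_2$ of positive size, and irreducible otherwise. A matrix $(m_{\alpha\beta})$ is $\mathcal J$-sign-symmetric with respect to a set $\mathcal J$ of its indices if $m_{\alpha\beta}\le 0$ whenever exactly one of $\alpha,\beta$ lies in $\mathcal J$, and $m_{\alpha\beta}<0$ only for such $\alpha,\beta$. To a set $\mathcal J$ of pairs $(i,j)$, $i<j$, associate the set $W\subseteq\{1,\dots,n\}^2$ that consists of all $(i,i)$, all $(i,j)$ with $i<j$ and $(i,j)\in\mathcal J$, and all $(i,j)$ with $i>j$ and $(j,i)\notin\mathcal J$. Call $W$ transitive if the relation $(i,j)\in W$ is a linear order on $\{1,\dots,n\}$. Eigenvalues are complex and are counted with algebraic multiplicity, simple means of algebraic multiplicity one, $\rho$ is the spectral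 radius, $A\wedge A$ is the operator induced by $A$ on the exterior square of $\mathbb R^n$, and $h(T)$ is the number of eigenvalues of an operator $T$ that have modulus $\rho(T)$. Theorem. Let $A$ be (entrywise) nonnegative and irreducible. Let $A^{(2)}$ be irreducible, nonzero (this is a restriction only for $n=2$, where it says $\det A\ne 0$), and $\mathcal J$-sign-symmetric with respect to a set $\mathcal J$ of pairs whose associated set $W$ is transitive. Then $h(A)=1$, and $A$ has simple positive eigenvalues $\lambda_1=\rho(A)$ and $\lambda_2$ such that $$\lambda_1>\lambda_2\ge|\lambda|\quad\text{for every eigenvalue }\lambda\ne\lambda_1\text{ of }A.$$ If $h(A\wedge A)=1$, then every eigenvalue of $A$ other than $\lambda_2$ has modulus different from $\lambda_2$. In general, $A$ has exactly $h(A\wedge A)$ eigenvalues of modulus $\lambda_2$, each of them is simple, and they are precisely the $h(A\wedge A)$-th roots of $\lambda_2^{h(A\wedge A)}$. -/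

import Mathlib

open scoped TensorProduct

/-! ### Matrices: irreducibility and `J`-sign-symmetry -/

/-- A square matrix is reducible if a simultaneous permutation of its rows and columns brings it
to the block form `[A₁ 0; B A₂]` with square diagonal blocks `A₁`, `A₂` of positive size. -/
def IsReducibleMatrix {ι : Type*} (A : Matrix ι ι ℝ) : Prop :=
  ∃ (p q : ℕ) (e : Fin p ⊕ Fin q ≃ ι), 0 < p ∧ 0 < q ∧
    ∃ (A₁ : Matrix (Fin p) (Fin p) ℝ) (B : Matrix (Fin q) (Fin p) ℝ)
      (A₂ : Matrix (Fin q) (Fin q) ℝ), A.submatrix e e = Matrix.fromBlocks A₁ 0 B A₂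

/-- A matrix is irreducible if it is not reducible. -/
def IsIrreducibleMatrix {ι : Type*} (A : Matrix ι ι ℝ) : Prop :=
  ¬ IsReducibleMatrix A

/-- `A` is `J`-sign-symmetric, with `J` as the witnessing set of indices: `a_ij ≤ 0` whenever
exactly one of `i`, `j` belongs to `J`, and `a_ij < 0` only for such `i`, `j`. -/
def IsJSignSymmetric {ι : Type*} (A : Matrix ι ι ℝ) (J : Set ι) : Prop :=
  ∀ i j, (Xor (i ∈ J) (j ∈ J) → A i j ≤ 0) ∧ (A i j < 0 → Xor (i ∈ J) (j ∈ J))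

/-! ### The second compound matrix and the set `W` -/

/-- The pairs `(i, j)` with `i < j`, which number the rows and columns of the second compound
matrix. -/
abbrev IncPair (n : ℕ) : Type := {p : Fin n × Fin n // p.1 < p.2}

/-- The second compound matrix: its entries are the minors of `A` with rows `i < j` and columns
`k < l`. -/
noncomputable def secondCompound {n : ℕ} (A : Matrix (Fin n) (Fin n) ℝ) :
    Matrix (IncPair n) (IncPair n) ℝ :=
  Matrix.of fun r c => (A.submatrix ![r.1.1, r.1.2] ![c.1.1, c.1.2]).det

/-- The set `W` corresponding to a set `J` of pairs: it contains the diagonal, the pairs `(i, j)`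
with `i < j` and `(i, j) ∈ J`, and the pairs `(i, j)` with `j < i` and `(j, i) ∉ J`. -/
def relSet {n : ℕ} (J : Set (IncPair n)) : Set (Fin n × Fin n) :=
  {p | p.1 = p.2 ∨ (∃ h : p.1 < p.2, (⟨(p.1, p.2), h⟩ : IncPair n) ∈ J) ∨
    (∃ h : p.2 < p.1, (⟨(p.2, p.1), h⟩ : IncPair n) ∉ J)}

/-- `W` is transitive if the binary relation `(i, j) ∈ W` is a linear order relation (reflexive,
antisymmetric, transitive and connected). -/
def IsTransitiveSet {n : ℕ} (W : Set (Fin n × Fin n)) : Prop :=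
  IsLinearOrder (Fin n) fun i j => (i, j) ∈ W

/-! ### Spectra of operators on finite-dimensional real spaces -/

section Operators

variable {V : Type*} [AddCommGroup V] [Module ℝ V] [Module.Finite ℝ V]

/-- The complex eigenvalues of a real operator, repeated according to their (algebraic)
multiplicity. -/
noncomputable def complexEigenvalues (T : V →ₗ[ℝ] V) : Multiset ℂ :=
  (T.baseChange ℂ).charpoly.roots

/-- `z` is a simple eigenvalue: its algebraic multiplicity is one. -/
def IsSimpleEigenvalue (T : V →ₗ[ℝ] V) (z : ℂ) : Prop :=
  (T.baseChange ℂ).charpoly.rootMultiplicity z = 1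

/-- The spectral radius of a real operator, as a real number. -/
noncomputable def specRadius (T : V →ₗ[ℝ] V) : ℝ :=
  (spectralRadius ℂ (T.baseChange ℂ : Module.End ℂ (ℂ ⊗[ℝ] V))).toReal

/-- The index of imprimitivity: the number of eigenvalues of modulus equal to the spectral
radius, counted with multiplicity. -/
noncomputable def imprimitivityIndex (T : V →ₗ[ℝ] V) : ℕ :=
  Multiset.card ((complexEigenvalues T).filter fun z => ‖z‖ = specRadius T)

end Operators

/-- The exterior square `A ∧ A` of the operator on `ℝⁿ` with the matrix `A`; it sends `x ∧ y` to
`Ax ∧ Ay`. -/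
noncomputable def exteriorSquare {n : ℕ} (A : Matrix (Fin n) (Fin n) ℝ) :
    ⋀[ℝ]^2 (Fin n → ℝ) →ₗ[ℝ] ⋀[ℝ]^2 (Fin n → ℝ) :=
  exteriorPower.map 2 (Matrix.toLin' A)

/-! The eigenvalues of `A ∧ A` are the products of pairs of eigenvalues of `A`, so Perron–Frobenius
theory for `A` and for `A ∧ A` together controls the two largest moduli in the spectrum of `A`. In a
basis of wedges, `A ∧ A` has the matrix `A^{(2)}`. Conjugation by a diagonal matrix of signs turns
that matrix into an irreducible nonnegative one. Hence `r₂ = ρ(A ∧ A)` is a simple positive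
eigenvalue, and the spectrum is invariant under every rotation that takes `r₂` to a peripheral
eigenvalue (`Matrix.IsIrreducible.roots_rotate`); the peripheral eigenvalues are therefore all the
`h`-th roots of `r₂ ^ h`, each simple (`Multiset.peripheral_of_rotate`). For `A` itself, let `m` be
the least index in the order given by `W`. Sign symmetry makes every minor `a_mm a_kl - a_ml a_km`
nonnegative, and irreducibility then forces `a_mm > 0`. A positive trace admits no nontrivial
rotation of the spectrum, so `r₁ = ρ(A)` is the only peripheral eigenvalue. It follows that the
products of modulus `r₂` are exactly those of `r₁` with an eigenvalue of modulus `λ₂ = r₂ / r₁`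
(`Multiset.peripheral_pair_products`). Division by `r₁` carries the peripheral spectrum of `A ∧ A`,
with multiplicities, to the eigenvalues of `A` of modulus `λ₂`. -/

/-! ### Eigenvalues of the exterior square -/

/-- The second compound matrix over a commutative ring. -/
def compoundTwo {R : Type*} [CommRing R] {n : ℕ} (M : Matrix (Fin n) (Fin n) R) :
    Matrix (IncPair n) (IncPair n) R :=
  Matrix.of fun r c => M r.1.1 c.1.1 * M r.1.2 c.1.2 - M r.1.1 c.1.2 * M r.1.2 c.1.1

theorem secondCompound_eq_compoundTwo {n : ℕ} (A : Matrix (Fin n) (Fin n) ℝ) :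
    secondCompound A = compoundTwo A := by
  ext r c
  rw [secondCompound, Matrix.of_apply, Matrix.det_fin_two]
  simp [compoundTwo]

/-- Pulling the order back along `f` makes `M` upper triangular. A reversed order covers lower
triangular matrices, which is how the lemma is applied. -/
theorem Matrix.charpoly_of_triangular {R m α : Type*} [CommRing R] [Fintype m] [DecidableEq m]
    [LinearOrder α] (f : m → α) (hf : Function.Injective f) (M : Matrix m m R)
    (hM : ∀ i j, f j < f i → M i j = 0) :
    M.charpoly = ∏ i, (Polynomial.X - Polynomial.C (M i i)) := by
  have key : ∀ (L : LinearOrder m), (∀ i j, L.lt i j ↔ f i < f j) →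
      M.charpoly = ∏ i, (Polynomial.X - Polynomial.C (M i i)) := by
    intro L hL
    convert Matrix.charpoly_of_isUpperTriangular M ?_
    intro i j hij
    exact hM i j ((hL j i).1 hij)
  exact key (LinearOrder.lift' f hf) fun i j => Iff.rfl

/-- An increasing pair is the same as an order embedding of `Fin 2`. -/
def incPairEquivOrderEmb (n : ℕ) : IncPair n ≃ (Fin 2 ↪o Fin n) where
  toFun p := OrderEmbedding.ofStrictMono ![p.1.1, p.1.2] (by
    have := p.2
    intro i j hij
    fin_cases i <;> fin_cases j <;> simp_all)
  invFun f := ⟨(f 0, f 1), f.strictMono (by simp)⟩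
  left_inv p := rfl
  right_inv f := by
    ext i
    fin_cases i <;> rfl

/-- An increasing pair is the same as a subset with two elements. -/
def incPairEquiv (n : ℕ) : IncPair n ≃ Set.powersetCard (Fin n) 2 :=
  (incPairEquivOrderEmb n).trans Set.powersetCard.ofFinEmbEquiv

theorem incPairEquiv_val {n : ℕ} (p : IncPair n) :
    (incPairEquiv n p).1 = {p.1.1, p.1.2} := by
  ext i
  have := Set.powersetCard.mem_ofFinEmbEquiv_iff_mem_range (incPairEquivOrderEmb n p) i
  change i ∈ incPairEquiv n p ↔ _
  rw [incPairEquiv, Equiv.trans_apply, this]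
  simp only [Set.mem_range, Fin.exists_fin_two, Finset.mem_insert, Finset.mem_singleton]
  exact or_congr eq_comm eq_comm

/-- In the basis of the wedges `b i ∧ b j` with `i < j`, the matrix entries of the exterior square
are the 2×2 minors. The result serves both over `ℝ` and over `ℂ`. -/
theorem charpoly_exteriorPower_map {R V : Type*} [CommRing R] [Nontrivial R] [AddCommGroup V]
    [Module R V] [Module.Finite R V] [Module.Free R V] {n : ℕ} (b : Module.Basis (Fin n) R V)
    (f : V →ₗ[R] V) :
    (exteriorPower.map 2 f).charpoly = (compoundTwo (LinearMap.toMatrix b b f)).charpoly := by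
  rw [← LinearMap.charpoly_toMatrix _ (b.exteriorPower 2),
    ← Matrix.charpoly_reindex (incPairEquiv n).symm]
  congr 1
  ext r c
  rw [Matrix.reindex_apply, Matrix.submatrix_apply, LinearMap.toMatrix_apply,
    exteriorPower.basis_apply, exteriorPower.basis_repr_apply,
    exteriorPower.map_apply_ιMulti_family, exteriorPower.ιMulti_family,
    exteriorPower.ιMultiDual_apply_ιMulti, Matrix.det_fin_two]
  simp only [Equiv.symm_symm, incPairEquiv, Equiv.trans_apply, Equiv.symm_apply_apply,
    Matrix.of_apply, Function.comp_apply, compoundTwo, LinearMap.toMatrix_apply,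
    Module.Basis.coord_apply]
  have h0 : ∀ p : IncPair n, incPairEquivOrderEmb n p 0 = p.1.1 := fun _ => rfl
  have h1 : ∀ p : IncPair n, incPairEquivOrderEmb n p 1 = p.1.2 := fun _ => rfl
  simp only [h0, h1]
  ring

-- Triangularization over an algebraically closed field.

universe u v

/-- The kernel of an eigenvector `φ` of the dual map is an invariant hyperplane. Induction gives it
a triangularizing basis, and a vector outside it is put in front. -/
theorem exists_triangularizing_basis {K : Type v} [Field K] [IsAlgClosed K] (n : ℕ) :
    ∀ (V : Type u) [AddCommGroup V] [Module K V] [FiniteDimensional K V],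
      Module.finrank K V = n → ∀ f : V →ₗ[K] V, ∃ b : Module.Basis (Fin n) K V,
        ∀ i j, j < i → b.repr (f (b i)) j = 0 := by
  induction n with
  | zero =>
    intro V _ _ _ hV f
    exact ⟨Module.finBasisOfFinrankEq K V hV, fun i => i.elim0⟩
  | succ n ih =>
    intro V _ _ _ hV f
    have : Nontrivial V := Module.nontrivial_of_finrank_pos (R := K) (by omega)
    obtain ⟨μ, hμ⟩ := Module.End.exists_eigenvalue (f.dualMap : Module.End K (Module.Dual K V))
    obtain ⟨φ, hφ⟩ := hμ.exists_hasEigenvector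
    have hφ0 : φ ≠ 0 := hφ.2
    have hφf : ∀ x, φ (f x) = μ * φ x := fun x => by
      have := LinearMap.congr_fun hφ.apply_eq_smul x
      simpa using this
    obtain ⟨y, hy⟩ : ∃ y, φ y = 1 := by
      obtain ⟨x, hx⟩ : ∃ x, φ x ≠ 0 := by
        by_contra! h
        exact hφ0 (LinearMap.ext h)
      exact ⟨(φ x)⁻¹ • x, by simp [hx]⟩
    let N := LinearMap.ker φ
    have hN : Module.finrank K N = n := by
      have := Module.Dual.finrank_ker_add_one_of_ne_zero hφ0
      change Module.finrank K N + 1 = _ at this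
      omega
    have hfN : ∀ x ∈ N, f x ∈ N := fun x hx => by
      rw [LinearMap.mem_ker] at hx ⊢
      rw [hφf, hx, mul_zero]
    obtain ⟨b, hb⟩ := ih N hN (f.restrict hfN)
    let b' := Module.Basis.mkFinCons y b
      (fun c x hx h => by
        have := congrArg φ h
        simpa [hy, LinearMap.mem_ker.1 hx] using this)
      (fun z => ⟨-φ z, by simp [N, hy]⟩)
    have hb' : (b' : Fin (n + 1) → V) = Fin.cons y ((↑) ∘ b) := Module.Basis.coe_mkFinCons ..
    have hbs : ∀ i : Fin n, b' i.succ = b i := fun i => by simp [hb']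
    have hrepr : ∀ x : N, b'.repr x = ∑ j, b.repr x j • Finsupp.single j.succ 1 := by
      intro x
      have hx : (x : V) = ∑ j, b.repr x j • b' j.succ := by
        have h := congrArg N.subtype (b.sum_repr x)
        rw [map_sum] at h
        simp only [hbs]
        exact h.symm
      rw [hx]
      simp only [map_sum, map_smul, Module.Basis.repr_self]
    refine ⟨b', fun i j hji => ?_⟩
    induction i using Fin.cases with
    | zero => exact absurd hji (Fin.not_lt_zero j)
    | succ i =>
      have hx : f (b' i.succ) = (f.restrict hfN (b i) : N) := by rw [hbs]; rfl
      rw [hx, hrepr]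
      induction j using Fin.cases with
      | zero => simp
      | succ j =>
        have := hb i j (Fin.succ_lt_succ_iff.1 hji)
        simpa [Finsupp.single_apply] using this

open Polynomial in
theorem roots_prod_X_sub_C_univ {ι K : Type*} [Fintype ι] [Field K] (c : ι → K) :
    (∏ i, (X - C (c i))).roots = Finset.univ.val.map c := by
  rw [← roots_multiset_prod_X_sub_C (Finset.univ.val.map c), Multiset.map_map]
  rfl

open Polynomial in
theorem roots_charpoly_of_triangularizing_basis {K V : Type*} [Field K]
    [AddCommGroup V] [Module K V] [FiniteDimensional K V] {n : ℕ} (f : V →ₗ[K] V)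
    (b : Module.Basis (Fin n) K V) (hb : ∀ i j, j < i → b.repr (f (b i)) j = 0) :
    f.charpoly.roots = Finset.univ.val.map fun i => b.repr (f (b i)) i := by
  have h : f.charpoly = ∏ i, (X - C (b.repr (f (b i)) i)) := by
    rw [← LinearMap.charpoly_toMatrix f b, Matrix.charpoly_of_triangular OrderDual.toDual
      OrderDual.toDual.injective]
    · simp [LinearMap.toMatrix_apply]
    · intro i j hij
      rw [LinearMap.toMatrix_apply]
      exact hb j i hij
  rw [h, roots_prod_X_sub_C_univ]

section AlgClosed

variable {K V : Type*} [Field K] [IsAlgClosed K] [AddCommGroup V] [Module K V]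
  [FiniteDimensional K V]

/-- Scaling an operator scales its eigenvalues. -/
theorem roots_charpoly_smul (c : K) (f : V →ₗ[K] V) :
    (c • f).charpoly.roots = f.charpoly.roots.map (c * ·) := by
  obtain ⟨b, hb⟩ := exists_triangularizing_basis (K := K) _ V rfl f
  rw [roots_charpoly_of_triangularizing_basis f b hb,
    roots_charpoly_of_triangularizing_basis (c • f) b fun i j hij => by simp [hb i j hij]]
  rw [Multiset.map_map]
  simp only [LinearMap.smul_apply, map_smul, Finsupp.smul_apply, smul_eq_mul, Function.comp_def]

/-- The eigenvalues of the exterior square of `f` are the products of two eigenvalues of `f`. -/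
theorem roots_charpoly_exteriorSquare (f : V →ₗ[K] V) :
    (exteriorPower.map 2 f).charpoly.roots =
      (f.charpoly.roots.powersetCard 2).map Multiset.prod := by
  obtain ⟨b, hb⟩ := exists_triangularizing_basis (K := K) _ V rfl f
  have hM : ∀ i j, i < j → LinearMap.toMatrix b b f i j = 0 := fun i j hij => by
    rw [LinearMap.toMatrix_apply]
    exact hb j i hij
  have hdiag : ∀ i, LinearMap.toMatrix b b f i i = b.repr (f (b i)) i := fun i =>
    LinearMap.toMatrix_apply ..
  have hset : Finset.powersetCard 2 (Finset.univ : Finset (Fin (Module.finrank K V))) =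
      Finset.univ.map ((incPairEquiv _).toEmbedding.trans (Function.Embedding.subtype _)) := by
    ext s
    simp only [Finset.mem_powersetCard_univ, Finset.mem_map, Finset.mem_univ, true_and]
    exact ⟨fun hs => ⟨(incPairEquiv _).symm ⟨s, hs⟩, by simp⟩,
      fun ⟨p, hp⟩ => hp ▸ (incPairEquiv _ p).2⟩
  -- The compound of a lower triangular matrix is lower triangular in the lexicographic order of
  -- pairs, with diagonal entries the products of two diagonal entries.
  rw [charpoly_exteriorPower_map b, Matrix.charpoly_of_triangular
    (fun p : IncPair _ => OrderDual.toDual (toLex (p.1.1, p.1.2))), roots_prod_X_sub_C_univ,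
    roots_charpoly_of_triangularizing_basis f b hb, Multiset.powersetCard_map, Multiset.map_map,
    ← Finset.map_val_val_powersetCard, Multiset.map_map, hset, Finset.map_val, Multiset.map_map]
  · refine Multiset.map_congr rfl fun p _ => ?_
    have hp := p.2
    have hval : ((incPairEquiv _ p).1).val = {p.1.1, p.1.2} := by
      rw [incPairEquiv_val, Finset.insert_val_of_notMem (by simpa using hp.ne)]
      rfl
    simp only [Function.comp_apply, Function.Embedding.trans_apply, Equiv.coe_toEmbedding,
      Function.Embedding.subtype_apply, hval]
    simp [compoundTwo, hM _ _ hp, hdiag]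
  · intro p q h
    simpa [Subtype.ext_iff, Prod.ext_iff] using h
  · intro r c hrc
    have hc := c.2
    rw [OrderDual.toDual_lt_toDual, Prod.Lex.toLex_lt_toLex] at hrc
    rw [compoundTwo, Matrix.of_apply]
    -- Either the first row of the 2×2 minor vanishes or its second column does.
    rcases hrc with h | ⟨h, h'⟩
    · rw [hM _ _ h, hM _ _ (h.trans hc)]
      ring
    · rw [hM _ _ h', hM r.1.1 c.1.2 (h.trans_lt hc)]
      ring

end AlgClosed

/-- The complex eigenvalues of the exterior square are those of the second compound matrix. -/
theorem complexEigenvalues_exteriorSquare {n : ℕ} (A : Matrix (Fin n) (Fin n) ℝ) :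
    complexEigenvalues (exteriorSquare A) =
      ((secondCompound A).map (algebraMap ℝ ℂ)).charpoly.roots := by
  rw [complexEigenvalues, LinearMap.charpoly_baseChange, exteriorSquare,
    charpoly_exteriorPower_map (Pi.basisFun ℝ (Fin n)), Matrix.charpoly_map,
    secondCompound_eq_compoundTwo, LinearMap.toMatrix_eq_toMatrix', LinearMap.toMatrix'_toLin']

theorem complexEigenvalues_toLin' {n : ℕ} (A : Matrix (Fin n) (Fin n) ℝ) :
    complexEigenvalues (Matrix.toLin' A) = (A.map (algebraMap ℝ ℂ)).charpoly.roots := by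
  rw [complexEigenvalues, LinearMap.charpoly_baseChange, Matrix.charpoly_map,
    Matrix.charpoly_toLin']

theorem roots_charpoly_secondCompound {n : ℕ} (A : Matrix (Fin n) (Fin n) ℝ) :
    ((secondCompound A).map (algebraMap ℝ ℂ)).charpoly.roots =
      ((A.map (algebraMap ℝ ℂ)).charpoly.roots.powersetCard 2).map Multiset.prod := by
  have h : (secondCompound A).map (algebraMap ℝ ℂ) = compoundTwo (A.map (algebraMap ℝ ℂ)) := by
    ext r c
    simp [secondCompound_eq_compoundTwo, compoundTwo]
  have := roots_charpoly_exteriorSquare (Matrix.toLin' (A.map (algebraMap ℝ ℂ)))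
  rwa [charpoly_exteriorPower_map (Pi.basisFun ℂ (Fin n)), LinearMap.toMatrix_eq_toMatrix',
    LinearMap.toMatrix'_toLin', Matrix.charpoly_toLin', ← h] at this

/-- The spectral radius is the largest modulus of an eigenvalue. -/
theorem specRadius_eq {V : Type*} [AddCommGroup V] [Module ℝ V] [Module.Finite ℝ V]
    (T : V →ₗ[ℝ] V) {r : ℝ} (hr : ∃ z ∈ complexEigenvalues T, ‖z‖ = r)
    (hle : ∀ z ∈ complexEigenvalues T, ‖z‖ ≤ r) : specRadius T = r := by
  have hmem : ∀ z, z ∈ spectrum ℂ (T.baseChange ℂ : Module.End ℂ (ℂ ⊗[ℝ] V)) ↔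
      z ∈ complexEigenvalues T := fun z => by
    rw [← Module.End.hasEigenvalue_iff_mem_spectrum, Module.End.hasEigenvalue_iff_isRoot_charpoly,
      complexEigenvalues, Polynomial.mem_roots (LinearMap.charpoly_monic _).ne_zero]
  obtain ⟨z, hz, rfl⟩ := hr
  have h : spectralRadius ℂ (T.baseChange ℂ : Module.End ℂ (ℂ ⊗[ℝ] V)) = ‖z‖₊ := by
    refine le_antisymm (iSup₂_le fun w hw => ?_)
      (le_iSup₂ (f := fun w (_ : w ∈ spectrum ℂ _) => (‖w‖₊ : ENNReal)) z ((hmem z).2 hz))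
    exact_mod_cast hle w ((hmem w).1 hw)
  rw [specRadius, h]
  simp

/-! ### The Perron–Frobenius theorem -/

section PerronFrobenius

open Matrix Finset

variable {ι : Type*} [Fintype ι] [DecidableEq ι]

theorem Matrix.pow_le_pow_mulVec {B : Matrix ι ι ℝ} (hB : ∀ i j, 0 ≤ B i j) {y : ι → ℝ} {s : ℝ}
    (hs : 0 ≤ s) (hy : ∀ i, s * y i ≤ (B *ᵥ y) i) (k : ℕ) (i : ι) :
    s ^ k * y i ≤ (B ^ k *ᵥ y) i := by
  induction k generalizing i with
  | zero => simp
  | succ k ih =>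
    calc s ^ (k + 1) * y i = s ^ k * (s * y i) := by ring
      _ ≤ s ^ k * (B *ᵥ y) i := by gcongr; exact hy i
      _ = ∑ j, B i j * (s ^ k * y j) := by
        simp only [mulVec, dotProduct, mul_sum]
        exact sum_congr rfl fun j _ => by ring
      _ ≤ ∑ j, B i j * (B ^ k *ᵥ y) j :=
        sum_le_sum fun j _ => mul_le_mul_of_nonneg_left (ih j) (hB i j)
      _ = (B ^ (k + 1) *ᵥ y) i := by rw [pow_succ', ← mulVec_mulVec]; rfl

omit [DecidableEq ι] in
theorem Matrix.map_mulVec_ofReal (B : Matrix ι ι ℝ) (y : ι → ℝ) (i : ι) :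
    (B.map (algebraMap ℝ ℂ) *ᵥ fun j => (y j : ℂ)) i = ((B *ᵥ y) i : ℝ) := by
  simp [mulVec, dotProduct]

theorem Matrix.mem_roots_charpoly_iff {C : Matrix ι ι ℂ} {z : ℂ} :
    z ∈ C.charpoly.roots ↔ ∃ v ≠ 0, C *ᵥ v = z • v := by
  rw [Polynomial.mem_roots (Matrix.charpoly_monic C).ne_zero, ← Matrix.charpoly_toLin',
    ← Module.End.hasEigenvalue_iff_isRoot_charpoly]
  constructor
  · intro h
    obtain ⟨v, hv⟩ := h.exists_hasEigenvector
    exact ⟨v, hv.2, by simpa using hv.apply_eq_smul⟩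
  · rintro ⟨v, hv, h⟩
    exact Module.End.hasEigenvalue_of_hasEigenvector (x := v)
      (Module.End.hasEigenvector_iff.2 ⟨Module.End.mem_eigenspace_iff.2 (by simpa using h), hv⟩)

section Gelfand

attribute [local instance] Matrix.linftyOpNormedRing Matrix.linftyOpNormedAlgebra

/-- A nonnegative matrix that expands a positive vector by the factor `s` has an eigenvalue of
modulus at least `s`. -/
theorem Matrix.exists_root_norm_ge [Nonempty ι] {B : Matrix ι ι ℝ} (hB : ∀ i j, 0 ≤ B i j)
    {y : ι → ℝ} (hy0 : ∀ i, 0 < y i) {s : ℝ} (hs : 0 ≤ s) (hy : ∀ i, s * y i ≤ (B *ᵥ y) i) :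
    ∃ z ∈ (B.map (algebraMap ℝ ℂ)).charpoly.roots, s ≤ ‖z‖ := by
  set C := B.map (algebraMap ℝ ℂ) with hC
  have : CompleteSpace (Matrix ι ι ℂ) := FiniteDimensional.complete ℂ _
  obtain ⟨z, hz, hzr⟩ := spectrum.exists_nnnorm_eq_spectralRadius C
  have hpow : ∀ k : ℕ, s ^ k ≤ ‖C ^ k‖ := by
    intro k
    -- At the largest entry, which is the sup norm of `y`, the bound `s ^ k * y ≤ B ^ k *ᵥ y`
    -- becomes a bound on the operator norm; Gelfand's formula then applies.
    obtain ⟨i, -, hi⟩ := exists_max_image univ y univ_nonempty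
    have h1 : ‖(fun j => (y j : ℂ))‖ = y i := by
      refine le_antisymm ((pi_norm_le_iff_of_nonneg (hy0 i).le).2 fun j => ?_) ?_
      · simpa [abs_of_pos (hy0 j)] using hi j (mem_univ j)
      · have := norm_le_pi_norm (fun j => (y j : ℂ)) i
        simpa [abs_of_pos (hy0 i)] using this
    have h2 : C ^ k = (B ^ k).map (algebraMap ℝ ℂ) := by
      rw [hC, Matrix.map_pow]
    have h3 : s ^ k * y i ≤ ‖C ^ k‖ * y i := by
      calc s ^ k * y i ≤ (B ^ k *ᵥ y) i := Matrix.pow_le_pow_mulVec hB hs hy k i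
        _ ≤ ‖(((B ^ k *ᵥ y) i : ℝ) : ℂ)‖ := by
          rw [Complex.norm_real]; exact le_abs_self _
        _ ≤ ‖C ^ k *ᵥ fun j => (y j : ℂ)‖ := by
          rw [← Matrix.map_mulVec_ofReal, ← h2]
          exact norm_le_pi_norm _ i
        _ ≤ ‖C ^ k‖ * y i := h1 ▸ Matrix.linfty_opNorm_mulVec _ _
    exact le_of_mul_le_mul_right h3 (hy0 i)
  have hlim := spectrum.pow_norm_pow_one_div_tendsto_nhds_spectralRadius C
  have hle : ENNReal.ofReal s ≤ spectralRadius ℂ C := by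
    refine ge_of_tendsto hlim (Filter.eventually_atTop.2 ⟨1, fun k hk => ?_⟩)
    refine ENNReal.ofReal_le_ofReal ?_
    calc s = (s ^ k) ^ (1 / k : ℝ) := by
          rw [one_div, Real.pow_rpow_inv_natCast hs (by omega)]
      _ ≤ ‖C ^ k‖ ^ (1 / k : ℝ) := by
          gcongr
          exact hpow k
  refine ⟨z, ?_, ?_⟩
  · rw [Polynomial.mem_roots (Matrix.charpoly_monic C).ne_zero]
    exact Matrix.mem_spectrum_iff_isRoot_charpoly.1 hz
  · rw [← hzr] at hle
    rw [← ENNReal.ofReal_coe_nnreal] at hle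
    exact (ENNReal.ofReal_le_ofReal_iff (norm_nonneg z)).1 hle

end Gelfand

/-- Every entry is positive in some power, and the sum of the chosen exponents bounds each of them.
The resulting positive matrix commutes with `B` and turns weak inequalities into strict ones. -/
theorem Matrix.IsIrreducible.exists_pos_sum_pow {B : Matrix ι ι ℝ} (hB : B.IsIrreducible) :
    ∃ K : ℕ, ∀ i j, 0 < (∑ k ∈ range K, B ^ k) i j := by
  have h := (Matrix.isIrreducible_iff_exists_pow_pos hB.nonneg).1 hB
  choose k hk hpos using h
  refine ⟨∑ i, ∑ j, k i j + 1, fun i j => ?_⟩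
  rw [Matrix.sum_apply]
  refine sum_pos' (fun l _ => Matrix.pow_apply_nonneg hB.nonneg l i j)
    ⟨k i j, mem_range.2 (Nat.lt_succ_of_le ?_), hpos i j⟩
  exact (single_le_sum (f := fun j => k i j) (fun _ _ => Nat.zero_le _) (mem_univ j)).trans
    (single_le_sum (f := fun i => ∑ j, k i j) (fun _ _ => Nat.zero_le _) (mem_univ i))

omit [DecidableEq ι] in
theorem Matrix.mulVec_pos_of_pos {P : Matrix ι ι ℝ} (hP : ∀ i j, 0 < P i j) {x : ι → ℝ}
    (hx : ∀ i, 0 ≤ x i) (hx0 : x ≠ 0) (i : ι) : 0 < (P *ᵥ x) i := by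
  obtain ⟨j, hj⟩ := Function.ne_iff.1 hx0
  exact sum_pos' (fun l _ => mul_nonneg (hP i l).le (hx l))
    ⟨j, mem_univ j, mul_pos (hP i j) ((hx j).lt_of_ne' hj)⟩

theorem Matrix.pow_mulVec_of_eigenvector {R : Type*} [CommRing R] {B : Matrix ι ι R} {x : ι → R}
    {r : R} (h : B *ᵥ x = r • x) (k : ℕ) : B ^ k *ᵥ x = r ^ k • x := by
  induction k with
  | zero => simp
  | succ k ih => rw [pow_succ', ← mulVec_mulVec, ih, mulVec_smul, h, smul_smul, pow_succ]

/-- A subinvariant vector for the spectral radius is a positive eigenvector. -/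
theorem Matrix.IsIrreducible.eigenvector_of_subinvariant [Nonempty ι] {B : Matrix ι ι ℝ}
    (hB : B.IsIrreducible) {r : ℝ} (hr : 0 ≤ r)
    (hmax : ∀ z ∈ (B.map (algebraMap ℝ ℂ)).charpoly.roots, ‖z‖ ≤ r) {x : ι → ℝ}
    (hx : ∀ i, 0 ≤ x i) (hx0 : x ≠ 0) (hsub : ∀ i, r * x i ≤ (B *ᵥ x) i) :
    B *ᵥ x = r • x ∧ ∀ i, 0 < x i := by
  obtain ⟨K, hK⟩ := hB.exists_pos_sum_pow
  set P := ∑ k ∈ range K, B ^ k with hP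
  have heq : B *ᵥ x = r • x := by
    -- If `B x - r x` is nonnegative and nonzero, applying `P` makes it positive everywhere. Then
    -- `B` expands `P x` by some `r + ε`, which forces an eigenvalue of modulus above `r`.
    by_contra hne
    have hPd := Matrix.mulVec_pos_of_pos hK (x := B *ᵥ x - r • x)
      (fun i => by simpa using hsub i) (sub_ne_zero.2 hne)
    have hPx := Matrix.mulVec_pos_of_pos hK hx hx0
    have hcomm : Commute P B := by
      rw [hP]
      exact Commute.sum_left _ _ _ fun k _ => (Commute.refl B).pow_left k
    have hBy : ∀ i, (P *ᵥ (B *ᵥ x - r • x)) i = (B *ᵥ (P *ᵥ x)) i - r * (P *ᵥ x) i := by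
      intro i
      rw [mulVec_sub, mulVec_smul, mulVec_mulVec, hcomm.eq, ← mulVec_mulVec]
      simp
    obtain ⟨i, -, hi⟩ := exists_min_image univ
      (fun i => (P *ᵥ (B *ᵥ x - r • x)) i / (P *ᵥ x) i) univ_nonempty
    set ε := (P *ᵥ (B *ᵥ x - r • x)) i / (P *ᵥ x) i
    have hε : 0 < ε := div_pos (hPd i) (hPx i)
    obtain ⟨z, hz, hzn⟩ := Matrix.exists_root_norm_ge hB.nonneg hPx (s := r + ε) (by positivity)
      (fun j => by
        have := (le_div_iff₀ (hPx j)).1 (hi j (mem_univ j))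
        rw [hBy] at this
        linarith)
    linarith [hmax z hz]
  refine ⟨heq, fun i => (hx i).lt_of_ne' fun h0 => ?_⟩
  have := Matrix.mulVec_pos_of_pos hK hx hx0 i
  rw [hP, sum_mulVec, Finset.sum_apply] at this
  refine this.ne' (sum_eq_zero fun k _ => ?_)
  rw [Matrix.pow_mulVec_of_eigenvector heq]
  simp [h0]

/-- The moduli of the entries of a peripheral eigenvector form a positive eigenvector. -/
theorem Matrix.IsIrreducible.norm_eigenvector [Nonempty ι] {B : Matrix ι ι ℝ}
    (hB : B.IsIrreducible) {r : ℝ}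
    (hmax : ∀ z ∈ (B.map (algebraMap ℝ ℂ)).charpoly.roots, ‖z‖ ≤ r) {z : ℂ} (hz : ‖z‖ = r)
    {v : ι → ℂ} (hv : B.map (algebraMap ℝ ℂ) *ᵥ v = z • v) (hv0 : v ≠ 0) :
    (B *ᵥ fun i => ‖v i‖) = r • (fun i => ‖v i‖) ∧ ∀ i, 0 < ‖v i‖ := by
  refine hB.eigenvector_of_subinvariant (hz ▸ norm_nonneg z) hmax (fun i => norm_nonneg _)
    (fun h => hv0 (funext fun i => norm_eq_zero.1 (congrFun h i))) fun i => ?_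
  calc r * ‖v i‖ = ‖(B.map (algebraMap ℝ ℂ) *ᵥ v) i‖ := by
        rw [hv, Pi.smul_apply, norm_smul, hz]
    _ ≤ ∑ j, ‖(B i j : ℂ) * v j‖ := norm_sum_le _ _
    _ = (B *ᵥ fun i => ‖v i‖) i := sum_congr rfl fun j _ => by
        rw [norm_mul, Complex.norm_real, Real.norm_of_nonneg (hB.nonneg i j)]

/-- An irreducible nonnegative matrix has a positive spectral radius, which is an eigenvalue with
a positive eigenvector. -/
theorem Matrix.IsIrreducible.exists_perron [Nonempty ι] {B : Matrix ι ι ℝ}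
    (hB : B.IsIrreducible) :
    ∃ r > 0, (∀ z ∈ (B.map (algebraMap ℝ ℂ)).charpoly.roots, ‖z‖ ≤ r) ∧
      ∃ x : ι → ℝ, (∀ i, 0 < x i) ∧ B *ᵥ x = r • x := by
  set C := B.map (algebraMap ℝ ℂ)
  have hne : C.charpoly.roots.toFinset.Nonempty := by
    obtain ⟨z, hz⟩ := IsAlgClosed.exists_root C.charpoly (by
      rw [Matrix.charpoly_degree_eq_dim]
      exact_mod_cast Fintype.card_ne_zero)
    exact ⟨z, by simpa [(Matrix.charpoly_monic C).ne_zero] using hz⟩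
  obtain ⟨z, hz, hmax⟩ := exists_max_image _ (fun z : ℂ => ‖z‖) hne
  simp only [Multiset.mem_toFinset] at hz hmax
  obtain ⟨v, hv0, hv⟩ := Matrix.mem_roots_charpoly_iff.1 hz
  obtain ⟨hx, hx0⟩ := hB.norm_eigenvector hmax rfl hv hv0
  refine ⟨‖z‖, ?_, hmax, _, hx0, hx⟩
  obtain ⟨i⟩ := ‹Nonempty ι›
  -- Some power with positive exponent has a positive diagonal entry; if `r` were zero, that power
  -- would kill the positive eigenvector.
  obtain ⟨k, hk, hpos⟩ := (Matrix.isIrreducible_iff_exists_pow_pos hB.nonneg).1 hB i i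
  have h1 : 0 < (B ^ k *ᵥ fun i => ‖v i‖) i :=
    sum_pos' (fun l _ => mul_nonneg (Matrix.pow_apply_nonneg hB.nonneg k i l) (hx0 l).le)
      ⟨i, mem_univ i, mul_pos hpos (hx0 i)⟩
  rw [Matrix.pow_mulVec_of_eigenvector hx] at h1
  refine (norm_nonneg z).lt_of_ne fun h0 => ?_
  simp [← h0, hk.ne'] at h1

/-- Eigenvectors for a peripheral eigenvalue are proportional. -/
theorem Matrix.IsIrreducible.eigenvector_unique [Nonempty ι] {B : Matrix ι ι ℝ}
    (hB : B.IsIrreducible) {r : ℝ}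
    (hmax : ∀ z ∈ (B.map (algebraMap ℝ ℂ)).charpoly.roots, ‖z‖ ≤ r) {z : ℂ} (hz : ‖z‖ = r)
    {u v : ι → ℂ} (hu : B.map (algebraMap ℝ ℂ) *ᵥ u = z • u) (hu0 : u ≠ 0)
    (hv : B.map (algebraMap ℝ ℂ) *ᵥ v = z • v) : ∃ c : ℂ, v = c • u := by
  obtain ⟨i⟩ := id ‹Nonempty ι›
  have hui : u i ≠ 0 := norm_pos_iff.1 ((hB.norm_eigenvector hmax hz hu hu0).2 i)
  -- The difference vanishes at `i`, whereas a nonzero peripheral eigenvector has no zero entry.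
  refine ⟨v i / u i, sub_eq_zero.1 ?_⟩
  by_contra hne
  have := (hB.norm_eigenvector hmax hz (v := v - (v i / u i) • u) (by
    rw [mulVec_sub, mulVec_smul, hu, hv, smul_sub, smul_comm z]) hne).2 i
  simp [hui] at this

/-- The spectral radius of an irreducible nonnegative matrix is a simple eigenvalue. -/
theorem Matrix.IsIrreducible.count_perron [Nonempty ι] {B : Matrix ι ι ℝ}
    (hB : B.IsIrreducible) {r : ℝ}
    (hmax : ∀ z ∈ (B.map (algebraMap ℝ ℂ)).charpoly.roots, ‖z‖ ≤ r) (hr : 0 < r)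
    {x : ι → ℝ} (hx0 : ∀ i, 0 < x i) (hx : B *ᵥ x = r • x) :
    (B.map (algebraMap ℝ ℂ)).charpoly.roots.count (r : ℂ) = 1 := by
  set C := B.map (algebraMap ℝ ℂ) with hC
  have hrn : ‖(r : ℂ)‖ = r := by simp [abs_of_pos hr]
  have hxC : C *ᵥ (fun i => (x i : ℂ)) = (r : ℂ) • fun i => (x i : ℂ) := by
    ext i
    rw [Matrix.map_mulVec_ofReal, hx]
    simp
  obtain ⟨i₀⟩ := id ‹Nonempty ι›
  have hxC0 : (fun i => (x i : ℂ)) ≠ 0 := fun h =>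
    (hx0 i₀).ne' (by simpa using congrFun h i₀)
  obtain ⟨y, hy0, hy⟩ : ∃ y : ι → ℝ, (∀ i, 0 < y i) ∧ Bᵀ *ᵥ y = r • y := by
    have hmax' : ∀ z ∈ (Bᵀ.map (algebraMap ℝ ℂ)).charpoly.roots, ‖z‖ ≤ r := by
      rw [Matrix.transpose_map, Matrix.charpoly_transpose]
      exact hmax
    have hmem : (r : ℂ) ∈ (Bᵀ.map (algebraMap ℝ ℂ)).charpoly.roots := by
      rw [Matrix.transpose_map, Matrix.charpoly_transpose]
      exact Matrix.mem_roots_charpoly_iff.2 ⟨_, hxC0, hxC⟩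
    obtain ⟨v, hv0, hv⟩ := Matrix.mem_roots_charpoly_iff.1 hmem
    obtain ⟨h1, h2⟩ := hB.transpose.norm_eigenvector hmax' hrn hv hv0
    exact ⟨_, h2, h1⟩
  have hortho : ∀ u : ι → ℂ, (fun i => (y i : ℂ)) ⬝ᵥ (C *ᵥ u - (r : ℂ) • u) = 0 := by
    intro u
    have hyC : Cᵀ *ᵥ (fun i => (y i : ℂ)) = (r : ℂ) • fun i => (y i : ℂ) := by
      ext i
      rw [hC, ← Matrix.transpose_map, Matrix.map_mulVec_ofReal, hy]
      simp
    rw [dotProduct_sub, dotProduct_mulVec, ← mulVec_transpose, hyC, dotProduct_smul,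
      smul_dotProduct, sub_self]
  -- The image of `C - r` is orthogonal to the positive left eigenvector `y`, but `y ⬝ᵥ x > 0`. So
  -- the image meets the eigenline of `x` only in zero, which excludes a Jordan block of size at
  -- least two.
  have hker : ∀ u : ι → ℂ, C *ᵥ (C *ᵥ u - (r : ℂ) • u) = (r : ℂ) • (C *ᵥ u - (r : ℂ) • u) →
      C *ᵥ u - (r : ℂ) • u = 0 := by
    intro u hu
    obtain ⟨c, hc⟩ := hB.eigenvector_unique hmax hrn hxC hxC0 hu
    have h := hortho u
    rw [hc, dotProduct_smul, smul_eq_mul, mul_eq_zero] at h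
    rcases h with h | h
    · rw [hc, h, zero_smul]
    · exfalso
      have hpos : 0 < ∑ i, y i * x i := sum_pos (fun i _ => mul_pos (hy0 i) (hx0 i)) univ_nonempty
      refine hpos.ne' ?_
      have h' : ((∑ i, y i * x i : ℝ) : ℂ) = 0 := by
        simpa [dotProduct] using h
      exact_mod_cast h'
  set f : Module.End ℂ (ι → ℂ) := Matrix.toLin' C with hf
  have hfe : ∀ u, (f - (r : ℂ) • (1 : Module.End ℂ (ι → ℂ))) u = C *ᵥ u - (r : ℂ) • u :=
    fun u => by simp [hf]
  have hmaxgen : f.maxGenEigenspace (r : ℂ) = f.eigenspace (r : ℂ) := by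
    refine le_antisymm (fun u hu => ?_) Module.End.eigenspace_le_maxGenEigenspace
    obtain ⟨k, hk⟩ := (Module.End.mem_maxGenEigenspace ..).1 hu
    rw [Module.End.mem_eigenspace_iff, ← sub_eq_zero]
    change (f - (r : ℂ) • (1 : Module.End ℂ (ι → ℂ))) u = 0
    clear hu
    induction k generalizing u with
    | zero =>
      rw [pow_zero, Module.End.one_apply] at hk
      rw [hk, map_zero]
    | succ k ih =>
      rw [pow_succ, Module.End.mul_apply] at hk
      have h := ih _ hk
      rw [hfe, hfe, sub_eq_zero] at h
      rw [hfe]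
      exact hker u h
  have hspan : f.eigenspace (r : ℂ) = Submodule.span ℂ {fun i => (x i : ℂ)} := by
    ext u
    rw [Module.End.mem_eigenspace_iff, Submodule.mem_span_singleton]
    constructor
    · intro hu
      obtain ⟨c, hc⟩ := hB.eigenvector_unique hmax hrn hxC hxC0 (v := u) hu
      exact ⟨c, hc.symm⟩
    · rintro ⟨c, rfl⟩
      rw [map_smul, hf, Matrix.toLin'_apply, hxC, smul_comm]
  rw [Polynomial.count_roots, ← Matrix.charpoly_toLin', ← LinearMap.finrank_maxGenEigenspace_eq,
    hmaxgen, hspan, finrank_span_singleton hxC0]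

theorem Complex.eq_one_of_norm_of_re {c : ℂ} (h : ‖c‖ = 1) (hre : c.re = 1) : c = 1 := by
  refine Complex.ext hre ?_
  have := Complex.sq_norm c
  rw [h, Complex.normSq_apply, hre] at this
  simpa using (by linarith : c.im * c.im = 0)

/-- The spectrum of an irreducible nonnegative matrix is invariant under the rotation given by
any peripheral eigenvalue. -/
theorem Matrix.IsIrreducible.roots_rotate [Nonempty ι] {B : Matrix ι ι ℝ}
    (hB : B.IsIrreducible) {r : ℝ}
    (hmax : ∀ z ∈ (B.map (algebraMap ℝ ℂ)).charpoly.roots, ‖z‖ ≤ r) (hr : 0 < r)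
    {z : ℂ} (hz : z ∈ (B.map (algebraMap ℝ ℂ)).charpoly.roots) (hzr : ‖z‖ = r) :
    (B.map (algebraMap ℝ ℂ)).charpoly.roots.map (z / r * ·) =
      (B.map (algebraMap ℝ ℂ)).charpoly.roots := by
  set C := B.map (algebraMap ℝ ℂ) with hC
  obtain ⟨v, hv0, hv⟩ := Matrix.mem_roots_charpoly_iff.1 hz
  obtain ⟨hx, hx0⟩ := hB.norm_eigenvector hmax hzr hv hv0
  set ω : ℂ := z / r with hω
  have hω1 : ‖ω‖ = 1 := by
    rw [hω, norm_div, hzr, Complex.norm_real, Real.norm_of_nonneg hr.le, div_self hr.ne']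
  have hzω : z = ω * r := by
    rw [hω, div_mul_cancel₀]
    exact_mod_cast hr.ne'
  set d : ι → ℂ := fun i => v i / ‖v i‖ with hd
  have hd1 : ∀ i, ‖d i‖ = 1 := fun i => by
    rw [hd, norm_div, Complex.norm_real, norm_norm, div_self (hx0 i).ne']
  have hvd : ∀ i, v i = ‖v i‖ * d i := fun i => by
    rw [hd, mul_div_cancel₀]
    exact_mod_cast (hx0 i).ne'
  have hd0 : ∀ i, d i ≠ 0 := fun i => norm_pos_iff.1 (by rw [hd1]; exact one_pos)
  -- This is the equality case of the triangle inequality: in row `i` a weighted average of unit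
  -- numbers equals one, so each number of nonzero weight is one.
  have hentry : ∀ i j, C i j * d j = ω * (d i * C i j) := by
    intro i j
    set e : ℂ := (starRingEnd ℂ) (ω * d i) with he
    have he1 : ω * d i * e = 1 := by
      rw [he, Complex.mul_conj, Complex.normSq_eq_norm_sq, norm_mul, hω1, hd1]
      simp
    have hen : ‖e‖ = 1 := by rw [he, RCLike.norm_conj, norm_mul, hω1, hd1, one_mul]
    have hn : ∀ j, ‖d j * e‖ = 1 := fun j => by rw [norm_mul, hd1, hen, one_mul]
    have h1 : ∑ j, (B i j : ℂ) * ‖v j‖ * (d j * e) = r * ‖v i‖ := by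
      have h := congrFun hv i
      have h' : ∑ j, (B i j : ℂ) * v j = z * v i := h
      calc ∑ j, (B i j : ℂ) * ‖v j‖ * (d j * e) = (∑ j, (B i j : ℂ) * v j) * e := by
            rw [sum_mul]
            refine sum_congr rfl fun j _ => ?_
            conv_rhs => rw [hvd j]
            ring
        _ = z * v i * e := by rw [h']
        _ = r * ‖v i‖ * (ω * d i * e) := by
            conv_lhs => rw [hvd i, hzω]
            ring
        _ = r * ‖v i‖ := by rw [he1, mul_one]
    have h2 : ∑ j, B i j * ‖v j‖ * (1 - (d j * e).re) = 0 := by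
      have h3 : ∑ j, B i j * ‖v j‖ = r * ‖v i‖ := congrFun hx i
      have h4 := congrArg Complex.re h1
      rw [Complex.re_sum] at h4
      simp only [← Complex.ofReal_mul, Complex.re_ofReal_mul, Complex.ofReal_re] at h4
      simp only [mul_sub, mul_one, sum_sub_distrib, h3, h4, sub_self]
    have h5 : ∀ j, 0 ≤ 1 - (d j * e).re := fun j =>
      sub_nonneg.2 ((Complex.re_le_norm _).trans (hn j).le)
    have h6 := (sum_eq_zero_iff_of_nonneg fun j _ =>
      mul_nonneg (mul_nonneg (hB.nonneg i j) (hx0 j).le) (h5 j)).1 h2 j (mem_univ j)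
    rcases mul_eq_zero.1 h6 with h7 | h7
    · have : B i j = 0 := (mul_eq_zero.1 h7).resolve_right (hx0 j).ne'
      simp [hC, this]
    · have h8 : d j * e = 1 := Complex.eq_one_of_norm_of_re (hn j) (by linarith)
      have h9 : d j = ω * d i := by
        calc d j = d j * (ω * d i * e) := by rw [he1, mul_one]
          _ = (d j * e) * (ω * d i) := by ring
          _ = ω * d i := by rw [h8, one_mul]
      rw [h9]
      ring
  let D : (Matrix ι ι ℂ)ˣ := ⟨diagonal d, diagonal fun i => (d i)⁻¹,
    by simp [hd0], by simp [hd0]⟩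
  have hCD : C = D.val * (ω • C) * D⁻¹.val := by
    rw [Units.eq_mul_inv_iff_mul_eq]
    ext i j
    rw [mul_diagonal, diagonal_mul, hentry]
    simp only [smul_apply, smul_eq_mul]
    ring
  conv_rhs => rw [hCD, Matrix.coe_units_inv, Matrix.charpoly_units_conj,
    ← Matrix.charpoly_toLin', map_smul,
    roots_charpoly_smul, Matrix.charpoly_toLin']

end PerronFrobenius

/-! ### Rotation-invariant multisets and roots of unity. -/

section Rotation

/-- The elements of largest modulus of a multiset invariant under the rotations that they
define. -/
theorem Multiset.peripheral_of_rotate {R : Multiset ℂ} {r : ℝ} (hr : 0 < r)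
    (h1 : R.count (r : ℂ) = 1)
    (hrot : ∀ z ∈ R, ‖z‖ = r → R.map (z / r * ·) = R) :
    (∀ z ∈ R, ‖z‖ = r → R.count z = 1) ∧
      ∀ z : ℂ, (z ∈ R ∧ ‖z‖ = r) ↔
        z ^ Multiset.card (R.filter fun z => ‖z‖ = r) =
          (r : ℂ) ^ Multiset.card (R.filter fun z => ‖z‖ = r) := by
  have hrC : (r : ℂ) ≠ 0 := by exact_mod_cast hr.ne'
  have hrn : ‖(r : ℂ)‖ = r := by simp [abs_of_pos hr]
  have hrR : (r : ℂ) ∈ R := Multiset.count_pos.1 (by omega)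
  have hz0 : ∀ z : ℂ, ‖z‖ = r → z ≠ 0 := fun z hz => norm_pos_iff.1 (hz ▸ hr)
  have hcount : ∀ z ∈ R, ‖z‖ = r → R.count z = 1 := by
    intro z hz hzr
    have hinj : Function.Injective (z / r * · : ℂ → ℂ) :=
      mul_right_injective₀ (div_ne_zero (hz0 z hzr) hrC)
    have := Multiset.count_map_eq_count' _ R hinj (r : ℂ)
    rwa [hrot z hz hzr, div_mul_cancel₀ _ hrC, h1] at this
  refine ⟨hcount, ?_⟩
  set F := R.filter fun z => ‖z‖ = r with hF
  set h := Multiset.card F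
  have hmem : ∀ z, z ∈ F ↔ z ∈ R ∧ ‖z‖ = r := fun z => Multiset.mem_filter
  have hnodup : F.Nodup := by
    rw [Multiset.nodup_iff_count_le_one]
    intro z
    by_cases hz : z ∈ F
    · have := (hmem z).1 hz
      exact (Multiset.count_le_of_le z (Multiset.filter_le _ _)).trans (hcount z this.1 this.2).le
    · simp [Multiset.count_eq_zero_of_notMem hz]
  have hFmap : ∀ z ∈ F, F.map (z / r * ·) = F := by
    intro z hz
    obtain ⟨hzR, hzr⟩ := (hmem z).1 hz
    conv_rhs => rw [hF, ← hrot z hzR hzr, Multiset.filter_map]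
    rw [hF]
    congr 1
    refine Multiset.filter_congr fun w _ => ?_
    simp [hzr, abs_of_pos hr, hr.ne']
  -- Multiplication by `z / r` permutes `F`, so it fixes the nonzero product of `F`, which it also
  -- multiplies by `(z / r) ^ h`.
  have hpow : ∀ z ∈ F, z ^ h = (r : ℂ) ^ h := by
    intro z hz
    have hprod := congrArg Multiset.prod (hFmap z hz)
    rw [Multiset.prod_map_mul, Multiset.map_const', Multiset.prod_replicate,
      Multiset.map_id'] at hprod
    have hF0 : F.prod ≠ 0 := Multiset.prod_ne_zero fun h0 => hz0 0 ((hmem 0).1 h0).2 rfl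
    have := mul_eq_right₀ hF0 |>.1 hprod
    rwa [div_pow, div_eq_one_iff_eq (pow_ne_zero _ hrC)] at this
  have hh : 0 < h := Multiset.card_pos_iff_exists_mem.2 ⟨r, (hmem _).2 ⟨hrR, hrn⟩⟩
  have hle : F ≤ Polynomial.nthRoots h ((r : ℂ) ^ h) :=
    (Multiset.le_iff_subset hnodup).2 fun z hz => (Polynomial.mem_nthRoots hh).2 (hpow z hz)
  -- `F` consists of `h` distinct roots of a polynomial of degree `h`, so it contains all of them.
  have heq : F = Polynomial.nthRoots h ((r : ℂ) ^ h) :=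
    Multiset.eq_of_le_of_card_le hle (Polynomial.card_nthRoots _ _)
  intro z
  rw [← hmem, heq, Polynomial.mem_nthRoots hh]

end Rotation

/-! ### Irreducibility and sign symmetry -/

/-- Otherwise, listing `S` before its complement would expose a zero upper right block. -/
theorem IsIrreducibleMatrix.exists_ne_zero {ι : Type*} [Finite ι] {M : Matrix ι ι ℝ}
    (hM : IsIrreducibleMatrix M) {S : Set ι} (hS : S.Nonempty) (hSc : Sᶜ.Nonempty) :
    ∃ i ∈ S, ∃ j ∉ S, M i j ≠ 0 := by
  classical
  have := Fintype.ofFinite ι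
  by_contra! h
  refine hM ⟨Fintype.card S, Fintype.card (Sᶜ : Set ι),
    ((Fintype.equivFin S).symm.sumCongr (Fintype.equivFin (Sᶜ : Set ι)).symm).trans
      (Equiv.Set.sumCompl S), ?_, ?_, ?_⟩
  · exact Fintype.card_pos_iff.2 hS.to_subtype
  · exact Fintype.card_pos_iff.2 hSc.to_subtype
  · set e := ((Fintype.equivFin S).symm.sumCongr (Fintype.equivFin (Sᶜ : Set ι)).symm).trans
      (Equiv.Set.sumCompl S)
    refine ⟨(M.submatrix e e).toBlocks₁₁, (M.submatrix e e).toBlocks₂₁,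
      (M.submatrix e e).toBlocks₂₂, ?_⟩
    conv_lhs => rw [← Matrix.fromBlocks_toBlocks (M.submatrix e e)]
    congr 1
    ext a b
    exact h _ ((Fintype.equivFin S).symm a).2 _ ((Fintype.equivFin (Sᶜ : Set ι)).symm b).2

/-- Irreducibility in the sense of block forms gives irreducibility in the sense of graphs for
every nonnegative matrix that has a nonzero entry wherever the given matrix has one. -/
theorem IsIrreducibleMatrix.isIrreducible {ι : Type*} [Fintype ι] [DecidableEq ι]
    {M N : Matrix ι ι ℝ} (hM : IsIrreducibleMatrix M) (hM0 : M ≠ 0) (hN : ∀ i j, 0 ≤ N i j)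
    (hMN : ∀ i j, M i j ≠ 0 → N i j ≠ 0) : N.IsIrreducible := by
  have hpos : ∀ i j, M i j ≠ 0 → 0 < N i j := fun i j h => (hN i j).lt_of_ne' (hMN i j h)
  have hmul : ∀ {k l i j p}, 0 < (N ^ k) i j → 0 < (N ^ l) j p → 0 < (N ^ (k + l)) i p := by
    intro k l i j p h1 h2
    rw [pow_add, Matrix.mul_apply]
    exact Finset.sum_pos' (fun q _ => mul_nonneg (Matrix.pow_apply_nonneg hN k i q)
      (Matrix.pow_apply_nonneg hN l q p)) ⟨j, Finset.mem_univ j, mul_pos h1 h2⟩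
  have hreach : ∀ i j, ∃ k, 0 < (N ^ k) i j := by
    intro i j
    by_contra hj
    obtain ⟨a, ⟨k, ha⟩, b, hb, hab⟩ := hM.exists_ne_zero (S := {j | ∃ k, 0 < (N ^ k) i j})
      ⟨i, 0, by simp⟩ ⟨j, hj⟩
    exact hb ⟨k + 1, hmul ha (by rw [pow_one]; exact hpos a b hab)⟩
  -- Passing through a fixed edge from `a` to `b` makes the exponent positive. This matters for a
  -- single index, where the zero matrix is irreducible in the block sense.
  obtain ⟨a, b, hab⟩ : ∃ a b, M a b ≠ 0 := by
    by_contra! h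
    exact hM0 (Matrix.ext h)
  rw [Matrix.isIrreducible_iff_exists_pow_pos hN]
  intro i j
  obtain ⟨k, hk⟩ := hreach i a
  obtain ⟨l, hl⟩ := hreach b j
  have hab' : 0 < (N ^ 1) a b := by rw [pow_one]; exact hpos a b hab
  exact ⟨k + 1 + l, by omega, hmul (hmul hk hab') hl⟩

/-- A `J`-sign-symmetric matrix is similar, by a diagonal matrix of signs, to a nonnegative
matrix with the same pattern of nonzero entries. -/
theorem IsJSignSymmetric.exists_nonneg {ι : Type*} [Fintype ι] [DecidableEq ι]
    {M : Matrix ι ι ℝ} {J : Set ι} (hJ : IsJSignSymmetric M J) :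
    ∃ N : Matrix ι ι ℝ, (∀ i j, 0 ≤ N i j) ∧ (∀ i j, M i j ≠ 0 → N i j ≠ 0) ∧
      N.charpoly = M.charpoly := by
  classical
  let s : ι → ℝ := fun i => if i ∈ J then 1 else -1
  have hss : ∀ i, s i * s i = 1 := fun i => by
    by_cases h : i ∈ J <;> simp [s, h]
  let D : (Matrix ι ι ℝ)ˣ := ⟨Matrix.diagonal s, Matrix.diagonal s, by simp [hss], by simp [hss]⟩
  have hD : ∀ i j, (D.val * M * D⁻¹.val) i j = s i * M i j * s j := fun i j => by
    change (Matrix.diagonal s * M * Matrix.diagonal s) i j = _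
    rw [Matrix.mul_diagonal, Matrix.diagonal_mul]
  refine ⟨D.val * M * D⁻¹.val, fun i j => ?_, fun i j h => ?_, ?_⟩
  · obtain ⟨h1, h2⟩ := hJ i j
    have h3 : ¬ Xor (i ∈ J) (j ∈ J) → 0 ≤ M i j := fun h => not_lt.1 fun h' => h (h2 h')
    rw [hD]
    by_cases hi : i ∈ J <;> by_cases hj : j ∈ J <;> simp_all [s, Xor]
  · rw [hD]
    exact mul_ne_zero (mul_ne_zero (left_ne_zero_of_mul_eq_one (hss i)) h)
      (left_ne_zero_of_mul_eq_one (hss j))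
  · rw [Matrix.coe_units_inv, Matrix.charpoly_units_conj]

theorem IsTransitiveSet.exists_least {n : ℕ} [Nonempty (Fin n)] {W : Set (Fin n × Fin n)}
    (hW : IsTransitiveSet W) : ∃ m, ∀ k, (m, k) ∈ W := by
  have hlin : IsLinearOrder (Fin n) fun i j => (i, j) ∈ W := hW
  have htot : ∀ i j, (i, j) ∈ W ∨ (j, i) ∈ W := fun i j => hlin.total i j
  have htr : IsTrans (Fin n) fun i j => (j, i) ∈ W :=
    ⟨fun a b c hab hbc => hlin.trans c b a hbc hab⟩
  have hdir : Directed (fun i j => (j, i) ∈ W) (id : Fin n → Fin n) := fun i j => by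
    rcases htot i j with h | h
    · exact ⟨i, (htot i i).elim id id, h⟩
    · exact ⟨j, h, (htot j j).elim id id⟩
  exact hdir.finite_le id

/-- A nonnegative irreducible matrix whose second compound matrix is `J`-sign-symmetric, with `J`
given by a linear order, has a positive diagonal entry at the least index. -/
theorem trace_pos_of_isJSignSymmetric_secondCompound {n : ℕ} {A : Matrix (Fin n) (Fin n) ℝ}
    (hA_nonneg : ∀ i j, 0 ≤ A i j) (hA_irr : IsIrreducibleMatrix A) (hn : Nontrivial (Fin n))
    {J : Set (IncPair n)} (hJ : IsJSignSymmetric (secondCompound A) J)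
    (hW : IsTransitiveSet (relSet J)) : 0 < A.trace := by
  obtain ⟨m, hm⟩ := hW.exists_least
  obtain ⟨p, hp⟩ := exists_ne m
  have hmk : ∀ k, k ≠ m → (∃ h : m < k, (⟨(m, k), h⟩ : IncPair n) ∈ J) ∨
      ∃ h : k < m, (⟨(k, m), h⟩ : IncPair n) ∉ J := fun k hk =>
    (hm k).resolve_left fun h => hk h.symm
  -- As `m` is least, the increasing pair formed by `m` and `k` lies in `J` exactly when `m < k`.
  -- Thus the sign prescribed by `J` is the sign of sorting the rows `m, k` and the columns `m, l`,
  -- and the unsorted minor is nonnegative.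
  have hminor : ∀ k l, k ≠ m → l ≠ m → A m l * A k m ≤ A m m * A k l := by
    intro k l hk hl
    have hsame : ∀ i j, (i ∈ J ↔ j ∈ J) → 0 ≤ secondCompound A i j := fun i j h =>
      not_lt.1 fun h' => by
        have := (hJ i j).2 h'
        rw [xor_iff_not_iff] at this
        exact this h
    have hdiff : ∀ i j, ¬ (i ∈ J ↔ j ∈ J) → secondCompound A i j ≤ 0 := fun i j h =>
      (hJ i j).1 ((xor_iff_not_iff _ _).2 h)
    rw [secondCompound_eq_compoundTwo] at hsame hdiff
    simp only [compoundTwo, Matrix.of_apply] at hsame hdiff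
    rcases hmk k hk with ⟨h, hkJ⟩ | ⟨h, hkJ⟩ <;> rcases hmk l hl with ⟨h', hlJ⟩ | ⟨h', hlJ⟩
    · have := hsame ⟨(m, k), h⟩ ⟨(m, l), h'⟩ (by tauto)
      dsimp only at this
      linarith
    · have := hdiff ⟨(m, k), h⟩ ⟨(l, m), h'⟩ (by tauto)
      dsimp only at this
      linarith
    · have := hdiff ⟨(k, m), h⟩ ⟨(m, l), h'⟩ (by tauto)
      dsimp only at this
      linarith
    · have := hsame ⟨(k, m), h⟩ ⟨(l, m), h'⟩ (by tauto)
      dsimp only at this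
      linarith
  -- Row `m` and column `m` both have a nonzero off-diagonal entry; with a zero diagonal entry their
  -- minor would be negative.
  obtain ⟨i, rfl, l, hl, hml⟩ := hA_irr.exists_ne_zero (S := {m}) ⟨m, rfl⟩ ⟨p, hp⟩
  obtain ⟨k, hk, j, hj, hkm⟩ := hA_irr.exists_ne_zero (S := {i}ᶜ) ⟨p, hp⟩ ⟨i, by simp⟩
  obtain rfl : j = i := by simpa using hj
  have h1 : 0 < A j l * A k j :=
    mul_pos ((hA_nonneg _ _).lt_of_ne' hml) ((hA_nonneg _ _).lt_of_ne' hkm)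
  have h2 : 0 < A j j := by
    refine (hA_nonneg j j).lt_of_ne fun h0 => ?_
    have := hminor k l hk hl
    rw [← h0, zero_mul] at this
    linarith
  exact Finset.sum_pos' (fun i _ => hA_nonneg i i) ⟨j, Finset.mem_univ j, h2⟩

/-- An irreducible nonnegative matrix with positive trace has only one peripheral eigenvalue. -/
theorem Matrix.IsIrreducible.eq_of_trace_pos {ι : Type*} [Fintype ι] [DecidableEq ι] [Nonempty ι]
    {B : Matrix ι ι ℝ} (hB : B.IsIrreducible) (htr : 0 < B.trace) {r : ℝ}
    (hmax : ∀ z ∈ (B.map (algebraMap ℝ ℂ)).charpoly.roots, ‖z‖ ≤ r) (hr : 0 < r)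
    {z : ℂ} (hz : z ∈ (B.map (algebraMap ℝ ℂ)).charpoly.roots) (hzr : ‖z‖ = r) : z = r := by
  have hrot := hB.roots_rotate hmax hr hz hzr
  have htrace : (B.map (algebraMap ℝ ℂ)).charpoly.roots.sum = (B.trace : ℂ) := by
    rw [← Matrix.trace_eq_sum_roots_charpoly]
    simp [Matrix.trace]
  have hsum := congrArg Multiset.sum hrot
  -- The rotation fixes the trace and also multiplies it by `z / r`.
  rw [Multiset.sum_map_mul_left, Multiset.map_id', htrace] at hsum
  have h1 := (mul_eq_right₀ (by exact_mod_cast htr.ne')).1 hsum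
  exact (div_eq_one_iff_eq (by exact_mod_cast hr.ne')).1 h1

/-- The products of pairs of elements of a multiset that has a single element `r₁` of largest
modulus: those of largest modulus come from the pairs that contain `r₁`. -/
theorem Multiset.peripheral_pair_products {R : Multiset ℂ} {r₁ r₂ : ℝ} (hr₁ : 0 < r₁)
    (hr₂ : 0 < r₂) (hcount : R.count (r₁ : ℂ) = 1) (hle : ∀ z ∈ R, ‖z‖ ≤ r₁)
    (hdom : ∀ z ∈ R, ‖z‖ = r₁ → z = r₁) (hmem : (r₂ : ℂ) ∈ (R.powersetCard 2).map Multiset.prod)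
    (hmax : ∀ z ∈ (R.powersetCard 2).map Multiset.prod, ‖z‖ ≤ r₂) :
    r₂ / r₁ < r₁ ∧ (∀ z ∈ R, z ≠ r₁ → ‖z‖ ≤ r₂ / r₁) ∧
      (R.filter fun z => ‖z‖ = r₂ / r₁).map ((r₁ : ℂ) * ·) =
        ((R.powersetCard 2).map Multiset.prod).filter fun z => ‖z‖ = r₂ := by
  obtain ⟨R', rfl⟩ := Multiset.exists_cons_of_mem 
    (Multiset.count_pos.1 (by omega : 0 < R.count (r₁ : ℂ)))
  have hn₁ : ‖(r₁ : ℂ)‖ = r₁ := by simp [abs_of_pos hr₁]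
  have hnot : (r₁ : ℂ) ∉ R' := by
    rw [Multiset.count_cons_self] at hcount
    exact Multiset.count_eq_zero.1 (by omega)
  have hlt : ∀ z ∈ R', ‖z‖ < r₁ := fun z hz =>
    (hle z (Multiset.mem_cons_of_mem hz)).lt_of_ne fun h =>
      hnot (hdom z (Multiset.mem_cons_of_mem hz) h ▸ hz)
  have hQ : (((r₁ : ℂ) ::ₘ R').powersetCard 2).map Multiset.prod =
      (R'.powersetCard 2).map Multiset.prod + R'.map ((r₁ : ℂ) * ·) := by
    rw [Multiset.powersetCard_cons, Multiset.map_add, Multiset.map_map, Multiset.powersetCard_one,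
      Multiset.map_map]
    simp [Function.comp_def]
  rw [hQ] at hmem hmax ⊢
  have hle' : ∀ z ∈ R', ‖z‖ ≤ r₂ / r₁ := fun z hz => by
    have := hmax _ (Multiset.mem_add.2 (Or.inr (Multiset.mem_map_of_mem _ hz)))
    rw [norm_mul, hn₁] at this
    rw [le_div_iff₀ hr₁]
    linarith
  have hm : 0 < r₂ / r₁ := div_pos hr₂ hr₁
  -- Without `r₁`, one factor is at most `r₂ / r₁` in modulus and the other is strictly below `r₁`.
  have hsmall : ∀ w ∈ (R'.powersetCard 2).map Multiset.prod, ‖w‖ < r₂ := by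
    intro w hw
    obtain ⟨s, hs, rfl⟩ := Multiset.mem_map.1 hw
    obtain ⟨hsR, hs2⟩ := Multiset.mem_powersetCard.1 hs
    obtain ⟨a, b, rfl⟩ := Multiset.card_eq_two.1 hs2
    have ha := hle' a (Multiset.mem_of_le hsR (by simp))
    have hb := hlt b (Multiset.mem_of_le hsR (by simp))
    calc ‖Multiset.prod {a, b}‖ = ‖a‖ * ‖b‖ := by simp
      _ ≤ r₂ / r₁ * ‖b‖ := by gcongr
      _ < r₂ / r₁ * r₁ := by gcongr
      _ = r₂ := div_mul_cancel₀ _ hr₁.ne'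
  -- Since `r₂` is attained, it is a product `r₁ * z` with `z` in `R'`, and `r₂ / r₁` is the modulus
  -- of that `z`.
  have hmlt : r₂ / r₁ < r₁ := by
    have hn₂ : ‖(r₂ : ℂ)‖ = r₂ := by simp [abs_of_pos hr₂]
    rcases Multiset.mem_add.1 hmem with h | h
    · exact absurd hn₂ (hsmall _ h).ne
    · obtain ⟨z, hz, hzr⟩ := Multiset.mem_map.1 h
      have h1 := congrArg norm hzr
      rw [norm_mul, hn₁, hn₂] at h1
      rw [← h1, mul_div_cancel_left₀ _ hr₁.ne']
      exact hlt z hz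
  refine ⟨hmlt, fun z hz hne => hle' z ((Multiset.mem_cons.1 hz).resolve_left hne), ?_⟩
  rw [Multiset.filter_cons_of_neg _ (by rw [hn₁]; exact hmlt.ne'), Multiset.filter_add,
    Multiset.filter_eq_nil.2 fun w hw => (hsmall w hw).ne, zero_add, Multiset.filter_map]
  congr 1
  refine Multiset.filter_congr fun z _ => ?_
  rw [Function.comp_apply, norm_mul, hn₁, eq_div_iff hr₁.ne', mul_comm]

/-! ### The main theorem. -/

theorem theorem13 {n : ℕ} (A : Matrix (Fin n) (Fin n) ℝ)
    (hA_nonneg : ∀ i j, 0 ≤ A i j)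
    (hA_irr : IsIrreducibleMatrix A)
    (hA2_irr : IsIrreducibleMatrix (secondCompound A))
    (hA2_ne : secondCompound A ≠ 0)
    (J : Set (IncPair n))
    (hJ : IsJSignSymmetric (secondCompound A) J)
    (hW : IsTransitiveSet (relSet J)) :
    imprimitivityIndex (Matrix.toLin' A) = 1 ∧
    ∃ l₁ l₂ : ℝ,
      l₁ = specRadius (Matrix.toLin' A) ∧
      IsSimpleEigenvalue (Matrix.toLin' A) (l₁ : ℂ) ∧
      IsSimpleEigenvalue (Matrix.toLin' A) (l₂ : ℂ) ∧
      0 < l₂ ∧ l₂ < l₁ ∧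
      (∀ z ∈ complexEigenvalues (Matrix.toLin' A), z ≠ (l₁ : ℂ) → ‖z‖ ≤ l₂) ∧
      (imprimitivityIndex (exteriorSquare A) = 1 →
        ∀ z ∈ complexEigenvalues (Matrix.toLin' A), z ≠ (l₂ : ℂ) → ‖z‖ ≠ l₂) ∧
      Multiset.card ((complexEigenvalues (Matrix.toLin' A)).filter fun z => ‖z‖ = l₂) =
        imprimitivityIndex (exteriorSquare A) ∧
      (∀ z ∈ complexEigenvalues (Matrix.toLin' A), ‖z‖ = l₂ →
        IsSimpleEigenvalue (Matrix.toLin' A) z) ∧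
      {z : ℂ | z ∈ complexEigenvalues (Matrix.toLin' A) ∧ ‖z‖ = l₂} =
        {z : ℂ | z ^ imprimitivityIndex (exteriorSquare A) =
          (l₂ : ℂ) ^ imprimitivityIndex (exteriorSquare A)} := by

  obtain ⟨⟨p, hp⟩, -, -⟩ : ∃ r c, secondCompound A r c ≠ 0 := by
    by_contra! h
    exact hA2_ne (Matrix.ext h)
  have hA_ne : A ≠ 0 := by
    rintro rfl
    refine hA2_ne ?_
    ext r c
    simp [secondCompound_eq_compoundTwo, compoundTwo]
  have hnt : Nontrivial (Fin n) := ⟨p.1, p.2, hp.ne⟩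
  have hne2 : Nonempty (IncPair n) := ⟨⟨p, hp⟩⟩
  have hA := hA_irr.isIrreducible hA_ne hA_nonneg fun _ _ h => h
  have htr := trace_pos_of_isJSignSymmetric_secondCompound hA_nonneg hA_irr hnt hJ hW
  obtain ⟨N, hN0, hN, hNchar⟩ := hJ.exists_nonneg
  have hNirr := hA2_irr.isIrreducible hA2_ne hN0 hN
  obtain ⟨r₁, hr₁, hmax₁, x₁, hx₁, hBx₁⟩ := hA.exists_perron
  obtain ⟨r₂, hr₂, hmax₂, x₂, hx₂, hBx₂⟩ := hNirr.exists_perron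
  have hcount₁ := hA.count_perron hmax₁ hr₁ hx₁ hBx₁
  have hcount₂ := hNirr.count_perron hmax₂ hr₂ hx₂ hBx₂
  have hdom := fun z => hA.eq_of_trace_pos (z := z) htr hmax₁ hr₁
  have hrot := fun z => hNirr.roots_rotate (z := z) hmax₂ hr₂
  have hNC : (N.map (algebraMap ℝ ℂ)).charpoly.roots = complexEigenvalues (exteriorSquare A) := by
    rw [complexEigenvalues_exteriorSquare, Matrix.charpoly_map, Matrix.charpoly_map, hNchar]
  have hQ : complexEigenvalues (exteriorSquare A) =
      ((complexEigenvalues (Matrix.toLin' A)).powersetCard 2).map Multiset.prod := by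
    rw [complexEigenvalues_exteriorSquare, roots_charpoly_secondCompound,
      complexEigenvalues_toLin']
  rw [hNC] at hmax₂ hcount₂ hrot
  rw [← complexEigenvalues_toLin'] at hmax₁ hcount₁ hdom
  have hsimple : ∀ z, IsSimpleEigenvalue (Matrix.toLin' A) z ↔
      (complexEigenvalues (Matrix.toLin' A)).count z = 1 := fun z => by
    rw [complexEigenvalues, Polynomial.count_roots, IsSimpleEigenvalue]
  set R := complexEigenvalues (Matrix.toLin' A) with hR
  set Q := complexEigenvalues (exteriorSquare A)
  have hn₁ : ‖(r₁ : ℂ)‖ = r₁ := by simp [abs_of_pos hr₁]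
  have hn₂ : ‖(r₂ : ℂ)‖ = r₂ := by simp [abs_of_pos hr₂]
  have hmem₁ : (r₁ : ℂ) ∈ R := Multiset.count_pos.1 (by omega)
  have hmem₂ : (r₂ : ℂ) ∈ Q := Multiset.count_pos.1 (by omega)
  have hρ₁ : specRadius (Matrix.toLin' A) = r₁ := specRadius_eq _ ⟨_, hmem₁, hn₁⟩ hmax₁
  have hρ₂ : specRadius (exteriorSquare A) = r₂ := specRadius_eq _ ⟨_, hmem₂, hn₂⟩ hmax₂
  obtain ⟨hlt, hle, hfilter⟩ := Multiset.peripheral_pair_products hr₁ hr₂ hcount₁ hmax₁ hdom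
    (hQ ▸ hmem₂) (hQ ▸ hmax₂)
  rw [← hQ] at hfilter
  obtain ⟨hQcount, hQroots⟩ := Multiset.peripheral_of_rotate hr₂ hcount₂ hrot
  have hh : imprimitivityIndex (exteriorSquare A) =
      Multiset.card (Q.filter fun z => ‖z‖ = r₂) := by
    rw [imprimitivityIndex, hρ₂]
  rw [← hh] at hQroots
  have hr₁C : (r₁ : ℂ) ≠ 0 := by exact_mod_cast hr₁.ne'
  have hinj : Function.Injective ((r₁ : ℂ) * · : ℂ → ℂ) := mul_right_injective₀ hr₁C
  have hmem : ∀ z : ℂ, (z ∈ R ∧ ‖z‖ = r₂ / r₁) ↔ ((r₁ : ℂ) * z ∈ Q ∧ ‖(r₁ : ℂ) * z‖ = r₂) := by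
    intro z
    rw [← Multiset.mem_filter (p := fun z => ‖z‖ = r₂ / r₁),
      ← Multiset.mem_filter (p := fun z => ‖z‖ = r₂), ← hfilter,
      Multiset.mem_map_of_injective hinj]
  have hroots : ∀ z : ℂ, (z ∈ R ∧ ‖z‖ = r₂ / r₁) ↔ z ^ imprimitivityIndex (exteriorSquare A) =
      ((r₂ / r₁ : ℝ) : ℂ) ^ imprimitivityIndex (exteriorSquare A) := by
    intro z
    rw [hmem, hQroots, mul_pow, Complex.ofReal_div, div_pow, eq_div_iff (pow_ne_zero _ hr₁C),
      mul_comm]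
  have hRcount : ∀ z ∈ R, ‖z‖ = r₂ / r₁ → R.count z = 1 := by
    intro z hz hzr
    obtain ⟨h1, h2⟩ := (hmem z).1 ⟨hz, hzr⟩
    rw [← hQcount _ h1 h2, ← Multiset.count_filter_of_pos (p := fun z => ‖z‖ = r₂) h2, ← hfilter,
      Multiset.count_map_eq_count' _ _ hinj,
      Multiset.count_filter_of_pos (p := fun z => ‖z‖ = r₂ / r₁) hzr]
  -- The positive number `r₂ / r₁` is trivially a root of its own equation, hence an eigenvalue.
  have hl₂ := (hroots ((r₂ / r₁ : ℝ) : ℂ)).2 rfl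
  refine ⟨?_, r₁, r₂ / r₁, hρ₁.symm, (hsimple _).2 hcount₁, (hsimple _).2 (hRcount _ hl₂.1 hl₂.2),
    div_pos hr₂ hr₁, hlt, hle, ?_, ?_, fun z hz hzr => (hsimple z).2 (hRcount z hz hzr),
    Set.ext hroots⟩
  · rw [imprimitivityIndex, hρ₁, ← hcount₁, Multiset.count, Multiset.countP_eq_card_filter]
    congr 1
    exact Multiset.filter_congr fun z hz => ⟨fun h => (hdom z hz h).symm, fun h => h ▸ hn₁⟩
  · intro h1 z hz hne hzr
    have := (hroots z).1 ⟨hz, hzr⟩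
    rw [h1, pow_one, pow_one] at this
    exact hne this
  · rw [hh, ← hfilter, Multiset.card_map]
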